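/- Let $\mathbb{F}_q$ be a finite field with $q$ elements, $A=\mathbb{F}_q[\theta]$, $K=\mathbb{F}_q(\theta)$, and let $K_\infty$ be the completion of $K$ at the infinite place. Put $$l_n=\prod_{j=1}^{n}(\theta-\theta^{q^j})\quad (n\ge 0),\qquad [m]=\theta^{q^m}-\theta\quad (m\ge 1),\qquad D_m=[m]\,[m-1]^{q}\cdots[1]^{q^{m-1}}.$$ For $s\ge 1$, integers $m_1,\dots,m_s$, positive integers $n_1,\dots,n_s$ and $k\ge 0$ put $$\mathcal{L}_{<k}\begin{pmatrix} m_1&\cdots&m_s\\ n_1&\cdots&n_s\end{pmatrix}=\sum_{k>i_1>\cdots>i_s\ge 0}\frac{\theta^{m_1q^{i_1}+\cdots+m_sq^{i_s}}}{l_{i_1}^{n_1}\cdots l_{i_s}^{n_s}}\in K,$$ and let $\mathcal{L}\begin{pmatrix} m_1&\cdots&m_s\\ n_1&\cdots&n_s\end{pmatrix}\in K_\infty$ be the sum of the corresponding series over all $i_1>\cdots>i_s\ge 0$, whenever it converges. For $d\geq 1$ let $f_d(x,y,z)=\sum_{j=0}^{d-1}(z-y)^j(x-y)^{d-1-j}$.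 For $d,r\ge 1$ define $c_{\underline m}\in A$, for $\underline m=(m_1,\dots,m_r)\in\mathbb{N}^r$, by $$\prod_{j=1}^{r} f_d(\theta^{q^{j-1}},y_j,\theta^{q^r})=\sum_{\underline m}c_{\underline m}\,y_1^{m_1}\cdots y_r^{m_r}\in A[y_1,\dots,y_r].$$ Theorem. Let $d,r\ge 1$. For every $k\ge r$, $$\mathcal{L}_{<k-r}\binom{0}{dq^r}=(-1)^r D_r\sum_{\underline m}c_{\underline m}\,\mathcal{L}_{<k}\begin{pmatrix} 0&m_1q&\cdots&m_rq^r\\ d&d(q-1)&\cdots&d(q-1)q^{r-1}\end{pmatrix}.$$ Moreover, the series $\mathcal{L}\binom{0}{dq^r}$ and, for every $\underline m$ with $c_{\underline m}\ne 0$, the series $\mathcal{L}\begin{pmatrix} 0&m_1q&\cdots&m_rq^r\\ d&d(q-1)&\cdots&d(q-1)q^{r-1}\end{pmatrix}$ converge in $K_\infty$, and $$\mathcal{L}\binom{0}{dq^r}=(-1)^r D_r\sum_{\underline m}c_{\underline m}\,\mathcal{L}\begin{pmatrix} 0&m_1q&\cdots&m_rq^r\\ d&d(q-1)&\cdots&d(q-1)q^{r-1}\end{pmatrix}.$$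 (The sums run over the finitely many $\underline m\in\mathbb{N}^r$ with $c_{\underline m}\neq 0$.) -/

import Mathlib

open scoped Polynomial

noncomputable section

namespace Carlitz

/-- The polynomial `f_d(x, y, z) = ((z - y)^d - (x - y)^d) / (z - x)`, written as the sum
`∑_{j < d} (z - y)^j (x - y)^(d - 1 - j)`, at elements `x, y, z` of a commutative ring. -/
def fd {R : Type*} [CommRing R] (d : ℕ) (x y z : R) : R :=
  ∑ j ∈ Finset.range d, (z - y) ^ j * (x - y) ^ (d - 1 - j)

section

variable (F : Type*) [Field F] [Fintype F]

/-- The product `∏_{j=1}^r f_d(θ^{q^{j-1}}, y_j, θ^{q^r})` in `A[y_1, …, y_r]`, where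
`A = 𝔽_q[θ]`, `F = 𝔽_q`, and `θ` is `Polynomial.X`; the index `j : Fin r` starts at `0`. -/
def coeffPoly (d r : ℕ) : MvPolynomial (Fin r) F[X] :=
  ∏ j : Fin r, fd d
    (MvPolynomial.C (Polynomial.X ^ Fintype.card F ^ (j : ℕ)))
    (MvPolynomial.X j)
    (MvPolynomial.C (Polynomial.X ^ Fintype.card F ^ r))

/-- The coefficient `c_m ∈ A` of `y_1^{m_1} ⋯ y_r^{m_r}` in `coeffPoly F d r`. -/
def c (d r : ℕ) (m : Fin r →₀ ℕ) : F[X] :=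
  MvPolynomial.coeff m (coeffPoly F d r)

/-- `[m] = θ^{q^m} - θ` for `m > 0` and `[0] = 1`, in `K = 𝔽_q(θ)`. -/
def bracket (m : ℕ) : RatFunc F :=
  if m = 0 then 1 else RatFunc.X ^ Fintype.card F ^ m - RatFunc.X

/-- `D_m = [m] [m-1]^q ⋯ [1]^{q^{m-1}}`. -/
def D (m : ℕ) : RatFunc F :=
  ∏ j ∈ Finset.range m, bracket F (m - j) ^ Fintype.card F ^ j

/-- `l_n = (θ - θ^q) (θ - θ^{q^2}) ⋯ (θ - θ^{q^n})`. -/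
def l (n : ℕ) : RatFunc F :=
  ∏ j ∈ Finset.range n, (RatFunc.X - RatFunc.X ^ Fintype.card F ^ (j + 1))

variable {F}

/-- The general term
`θ^{m_1 q^{i_1} + ⋯ + m_s q^{i_s}} / (l_{i_1}^{n_1} ⋯ l_{i_s}^{n_s})`. -/
def term {s : ℕ} (m : Fin s → ℤ) (n : Fin s → ℕ) (i : Fin s → ℕ) : RatFunc F :=
  RatFunc.X ^ (∑ j, m j * (Fintype.card F : ℤ) ^ i j) / ∏ j, l F (i j) ^ n j

open Classical in
/-- The finite multiple sum `𝓛_{<k}(m_1, …, m_s; n_1, …, n_s)`: the sum of the general term over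
all integer tuples with `k > i_1 > ⋯ > i_s ≥ 0`. -/
def finL {s : ℕ} (k : ℕ) (m : Fin s → ℤ) (n : Fin s → ℕ) : RatFunc F :=
  ∑ i ∈ (Fintype.piFinset fun _ : Fin s => Finset.range k) with StrictAnti i, term m n i

variable [DecidableEq (RatFunc F)]

/-- The general term, in `K_∞`, of the series `𝓛(m_1, …, m_s; n_1, …, n_s)`, indexed by all
integer tuples with `i_1 > ⋯ > i_s ≥ 0`. -/
def termInfty {s : ℕ} (m : Fin s → ℤ) (n : Fin s → ℕ) (i : {i : Fin s → ℕ // StrictAnti i}) :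
    RatFunc.CompletionAtInfty F :=
  algebraMap (RatFunc F) (RatFunc.CompletionAtInfty F) (term m n i.1)

/-- The value `𝓛(m_1, …, m_s; n_1, …, n_s) ∈ K_∞` of the Carlitz multiple polylogarithm
(the sum of the series; meaningful if the series converges). -/
def L {s : ℕ} (m : Fin s → ℤ) (n : Fin s → ℕ) : RatFunc.CompletionAtInfty F :=
  ∑' i, termInfty m n i

end

section

variable (F : Type*) [Fintype F]

/-- The upper row `(0, m_1 q, …, m_r q^r)`. -/
def upperRow {r : ℕ} (m : Fin r →₀ ℕ) : Fin (r + 1) → ℤ :=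
  Fin.cons 0 fun j => (m j : ℤ) * (Fintype.card F : ℤ) ^ ((j : ℕ) + 1)

/-- The lower row `(d, d(q-1), …, d(q-1) q^{r-1})`. -/
def lowerRow (d r : ℕ) : Fin (r + 1) → ℕ :=
  Fin.cons d fun j => d * (Fintype.card F - 1) * Fintype.card F ^ (j : ℕ)

end

end Carlitz

end

namespace Carlitz

/-! By Frobenius, `D_r = ∏ (θ^{q^r} - θ^{q^{j-1}})`, so multiplying `∏ f_d` by `D_r` clears its
denominators: at `y_j = θ^{q^{j+i_j}}` each factor becomes a difference of two `d`-th powers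
(`D_mul_sum_coeffPoly`). The right-hand side is then one nested sum of products of one-variable
factors. It telescopes from the innermost variable outwards, since both differences of powers of `θ`
are Frobenius powers of ratios of consecutive `l_n` (`telescopingFactor_mul`). Each summation
contributes a sign, and what remains is `(l_n / l_{n-r}^{q^r})^d`; the outer factor `l_n^{-d}` turns
it into `l_{n-r}^{-dq^r}`. The identity in `K_∞` is the limit over `k`; convergence follows from
degree estimates. -/

theorem strictAnti_cons_iff {s : ℕ} {a : ℕ} {f : Fin s → ℕ} :
    StrictAnti (Fin.cons a f : Fin (s + 1) → ℕ) ↔ (∀ j, f j < a) ∧ StrictAnti f := by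
  simp [StrictAnti, Fin.forall_fin_succ]

open Classical in
/-- A sum over strictly decreasing tuples, split according to the largest entry. -/
theorem sum_strictAnti_succ {R : Type*} [CommRing R] (s k : ℕ) (φ : Fin (s + 1) → ℕ → R) :
    ∑ i ∈ (Fintype.piFinset fun _ : Fin (s + 1) => Finset.range k) with StrictAnti i,
      ∏ j, φ j (i j) =
    ∑ a ∈ Finset.range k, φ 0 a *
      ∑ i ∈ (Fintype.piFinset fun _ : Fin s => Finset.range a) with StrictAnti i,
        ∏ j, φ j.succ (i j) := by
  simp_rw [Finset.mul_sum]
  rw [Finset.sum_sigma']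
  symm
  refine Finset.sum_bij' (fun x _ => (Fin.cons x.1 x.2 : Fin (s + 1) → ℕ))
    (fun i _ => ⟨i 0, Fin.tail i⟩) ?_ ?_ ?_ ?_ ?_
  · rintro ⟨a, f⟩ h
    simp only [Finset.mem_sigma, Finset.mem_range, Finset.mem_filter, Fintype.mem_piFinset] at h
    simp only [Finset.mem_filter, Fintype.mem_piFinset, Finset.mem_range, strictAnti_cons_iff]
    refine ⟨Fin.cases h.1 fun j => ?_, h.2.1, h.2.2⟩
    simpa using (h.2.1 j).trans h.1
  · intro i h
    simp only [Finset.mem_filter, Fintype.mem_piFinset, Finset.mem_range] at h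
    simp only [Finset.mem_sigma, Finset.mem_range, Finset.mem_filter, Fintype.mem_piFinset]
    exact ⟨h.1 0, fun j => h.2 (Fin.succ_pos j), fun _ _ hab => h.2 (Fin.succ_lt_succ_iff.2 hab)⟩
  · rintro ⟨a, f⟩ _
    simp
  · intro i _
    simp
  · rintro ⟨a, f⟩ _
    simp [Fin.prod_univ_succ]

variable {F : Type*} [Field F] [Fintype F]

/-! ### Frobenius, `l_n` and `D_r` -/

theorem sub_pow_card_pow {R : Type*} [CommRing R] [Algebra F R] (x y : R) (n : ℕ) :
    (x - y) ^ Fintype.card F ^ n = x ^ Fintype.card F ^ n - y ^ Fintype.card F ^ n := by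
  have h := map_sub (FiniteField.frobeniusAlgHom F R ^ n) x y
  simpa only [AlgHom.coe_pow, FiniteField.coe_frobeniusAlgHom, pow_iterate] using h

omit [Fintype F] in
theorem X_sub_X_pow_ne_zero {n : ℕ} (hn : 1 < n) :
    (RatFunc.X - RatFunc.X ^ n : RatFunc F) ≠ 0 := by
  rw [sub_ne_zero]
  intro h
  have h' : algebraMap F[X] (RatFunc F) Polynomial.X =
      algebraMap F[X] (RatFunc F) (Polynomial.X ^ n) := by simpa [RatFunc.algebraMap_X] using h
  have := congrArg Polynomial.natDegree (RatFunc.algebraMap_injective F h')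
  simp at this
  omega

theorem one_lt_card_pow_succ (n : ℕ) : 1 < Fintype.card F ^ (n + 1) :=
  Nat.one_lt_pow n.succ_ne_zero Fintype.one_lt_card

theorem l_ne_zero (n : ℕ) : l F n ≠ 0 :=
  Finset.prod_ne_zero_iff.2 fun j _ => X_sub_X_pow_ne_zero (one_lt_card_pow_succ j)

theorem l_zero : l F 0 = 1 := by simp [l]

theorem l_succ (n : ℕ) :
    l F (n + 1) = l F n * (RatFunc.X - RatFunc.X ^ Fintype.card F ^ (n + 1)) :=
  Finset.prod_range_succ _ _

theorem fd_mul_sub {R : Type*} [CommRing R] (d : ℕ) (x y z : R) :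
    fd d x y z * (z - x) = (z - y) ^ d - (x - y) ^ d := by
  have h := (Commute.all (z - y) (x - y)).geom_sum₂_mul d
  rw [fd, ← h]
  ring

/-- Frobenius turns `[r-j]^{q^j}` into `θ^{q^r} - θ^{q^j}`; these are the denominators `z - x` of
the `f_d`. -/
theorem D_eq_prod (r : ℕ) :
    D F r = ∏ j : Fin r, ((RatFunc.X : RatFunc F) ^ Fintype.card F ^ r -
      RatFunc.X ^ Fintype.card F ^ (j : ℕ)) := by
  rw [D, ← Fin.prod_univ_eq_prod_range fun j => bracket F (r - j) ^ Fintype.card F ^ j]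
  refine Finset.prod_congr rfl fun j _ => ?_
  have hj := j.2
  rw [bracket, if_neg (by omega), sub_pow_card_pow (F := F), ← pow_mul, ← pow_add,
    Nat.sub_add_cancel hj.le]

/-! ### The telescoping sum -/

variable (F) in
/-- The factor in the variable `i`, for the powers `q^a` and `q^b` of Frobenius, of the
multiple sum that telescopes. -/
noncomputable def telescopingFactor (d a b i : ℕ) : RatFunc F :=
  ((RatFunc.X ^ Fintype.card F ^ b - RatFunc.X ^ Fintype.card F ^ (a + 1 + i)) ^ d -
    (RatFunc.X ^ Fintype.card F ^ a - RatFunc.X ^ Fintype.card F ^ (a + 1 + i)) ^ d) /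
    l F i ^ (d * (Fintype.card F - 1) * Fintype.card F ^ a)

variable (F) in
/-- The value, up to sign, of the iterated telescoping sum in `s` variables below `n`. -/
noncomputable def telescopedValue (d a s n : ℕ) : RatFunc F :=
  if n < s then 0 else (l F n ^ Fintype.card F ^ a / l F (n - s) ^ Fintype.card F ^ (a + s)) ^ d

/-- The two differences in the factor are `(l_{i-s}/l_{i-s-1})^{q^{a+s+1}}` (for `i > s`) and
`(l_{i+1}/l_i)^{q^a}`. The denominator lowers `l_i^{q^{a+1}}` to `l_i^{q^a}`, so the two terms are
consecutive values. -/
theorem telescopingFactor_mul {d : ℕ} (hd : 1 ≤ d) (a s i : ℕ) :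
    telescopingFactor F d a (a + (s + 1)) i * telescopedValue F d (a + 1) s i =
      telescopedValue F d a (s + 1) i - telescopedValue F d a (s + 1) (i + 1) := by
  rcases lt_or_ge i s with h | h
  · simp [telescopedValue, h, h.trans (Nat.lt_succ_self s)]
  obtain ⟨t, rfl⟩ := Nat.exists_eq_add_of_le h
  obtain ⟨Q, hQ⟩ : ∃ Q, Fintype.card F = Q + 1 :=
    ⟨Fintype.card F - 1, by have := Fintype.card_pos (α := F); omega⟩
  set q := Fintype.card F with hq
  have hsec : (RatFunc.X ^ q ^ a - RatFunc.X ^ q ^ (a + 1 + (s + t)) : RatFunc F) =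
      (l F (s + t + 1) / l F (s + t)) ^ q ^ a := by
    rw [l_succ, mul_div_cancel_left₀ _ (l_ne_zero _), sub_pow_card_pow (F := F), ← hq, ← pow_mul,
      ← pow_add]
    congr 3
    ring
  have hne := l_ne_zero (F := F) (s + t)
  have hlow : l F (s + t) ^ (d * (q - 1) * q ^ a) =
      (l F (s + t) ^ q ^ (a + 1)) ^ d / (l F (s + t) ^ q ^ a) ^ d := by
    rw [eq_div_iff (by positivity), ← pow_mul, ← pow_mul, ← pow_add, hQ]
    congr 1
    simp only [Nat.add_sub_cancel]
    ring
  have h1 : telescopedValue F d (a + 1) s (s + t) =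
      (l F (s + t) ^ q ^ (a + 1) / l F t ^ q ^ (a + 1 + s)) ^ d := by
    simp [telescopedValue, hq]
  have h2 : telescopedValue F d a (s + 1) (s + t + 1) =
      (l F (s + t + 1) ^ q ^ a / l F t ^ q ^ (a + 1 + s)) ^ d := by
    rw [telescopedValue, if_neg (by omega), show s + t + 1 - (s + 1) = t by omega,
      show a + (s + 1) = a + 1 + s by ring]
  have ht := l_ne_zero (F := F) t
  have h3 : telescopedValue F d a (s + 1) (s + t) =
      (RatFunc.X ^ q ^ (a + (s + 1)) - RatFunc.X ^ q ^ (a + 1 + (s + t))) ^ d *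
      (l F (s + t) ^ q ^ a / l F t ^ q ^ (a + 1 + s)) ^ d := by
    -- At `i = s` the two powers of `θ` coincide and the term vanishes because `d ≥ 1`, in agreement
    -- with the value `0` below `s + 1`.
    cases t with
    | zero =>
      rw [telescopedValue, if_pos (by omega), show a + (s + 1) = a + 1 + (s + 0) by ring,
        sub_self, zero_pow (by omega), zero_mul]
    | succ u =>
      have hu := l_ne_zero (F := F) u
      have hfac : (RatFunc.X ^ q ^ (a + (s + 1)) - RatFunc.X ^ q ^ (a + 1 + (s + (u + 1))) :
          RatFunc F) = (l F (u + 1) / l F u) ^ q ^ (a + 1 + s) := by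
        rw [l_succ, mul_div_cancel_left₀ _ (l_ne_zero _), sub_pow_card_pow (F := F), ← hq,
          ← pow_mul, ← pow_add]
        congr 3 <;> ring
      rw [telescopedValue, if_neg (by omega), show s + (u + 1) - (s + 1) = u by omega, hfac,
        ← mul_pow, show a + (s + 1) = a + 1 + s by ring]
      congr 1
      simp only [← hq, div_pow]
      field_simp
  rw [telescopingFactor, h1, h2, h3]
  simp only [← hq]
  rw [hlow, hsec]
  simp only [div_pow]
  field_simp

open Classical in
-- Induction on `s`, shifting `a` so that the top exponent `a + s` stays fixed; the value at `0`
-- vanishes, so each summation leaves minus the value at the upper end.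
theorem sum_prod_telescopingFactor {d : ℕ} (hd : 1 ≤ d) (s a n : ℕ) :
    ∑ i ∈ (Fintype.piFinset fun _ : Fin s => Finset.range n) with StrictAnti i,
      ∏ j : Fin s, telescopingFactor F d (a + j) (a + s) (i j) =
    (-1) ^ s * telescopedValue F d a s n := by
  induction s generalizing a n with
  | zero =>
    have := l_ne_zero (F := F) n
    simp [telescopedValue, Finset.filter_true_of_mem, Subsingleton.strictAnti, this]
  | succ s ih =>
    rw [sum_strictAnti_succ s n fun j i => telescopingFactor F d (a + j) (a + (s + 1)) i]
    have h (m : ℕ) : ∑ i ∈ (Fintype.piFinset fun _ : Fin s => Finset.range m) with StrictAnti i,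
        ∏ j : Fin s, telescopingFactor F d (a + (j.succ : Fin (s + 1))) (a + (s + 1)) (i j) =
        (-1) ^ s * telescopedValue F d (a + 1) s m := by
      rw [← ih]
      simp only [Fin.val_succ, add_assoc, add_comm 1]
    simp_rw [h, mul_left_comm _ ((-1 : RatFunc F) ^ s), Fin.val_zero, add_zero,
      telescopingFactor_mul hd]
    rw [← Finset.mul_sum, Finset.sum_range_sub']
    have h0 : telescopedValue F d a (s + 1) 0 = 0 := by simp [telescopedValue]
    rw [h0]
    ring

/-! ### The identity of finite sums -/

theorem term_eq_prod {s : ℕ} (m : Fin s → ℤ) (n i : Fin s → ℕ) :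
    (term m n i : RatFunc F) =
      ∏ j, RatFunc.X ^ (m j * (Fintype.card F : ℤ) ^ i j) / l F (i j) ^ n j := by
  rw [term, Finset.prod_div_distrib]
  congr 1
  generalize Finset.univ (α := Fin s) = S
  induction S using Finset.cons_induction with
  | empty => simp
  | cons a S ha ih => rw [Finset.sum_cons, Finset.prod_cons, zpow_add₀ RatFunc.X_ne_zero, ih]

theorem finL_singleton (k N : ℕ) :
    (finL k ![0] ![N] : RatFunc F) = ∑ i ∈ Finset.range k, (l F i ^ N)⁻¹ := by
  classical
  have h := sum_strictAnti_succ 0 k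
    (fun j i => (RatFunc.X ^ ((![0] : Fin 1 → ℤ) j * (Fintype.card F : ℤ) ^ i) /
      l F i ^ (![N] : Fin 1 → ℕ) j : RatFunc F))
  simp only [finL, term_eq_prod]
  convert h using 1
  simp [Subsingleton.strictAnti]

/-- Evaluation of `coeffPoly` at powers of `θ`, multiplied by `D_r`. -/
theorem D_mul_sum_coeffPoly (d r : ℕ) (y : Fin r → RatFunc F) :
    D F r * ∑ m ∈ (coeffPoly F d r).support,
      algebraMap F[X] (RatFunc F) (c F d r m) * ∏ j, y j ^ m j =
    ∏ j : Fin r, ((RatFunc.X ^ Fintype.card F ^ r - y j) ^ d -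
      (RatFunc.X ^ Fintype.card F ^ (j : ℕ) - y j) ^ d) := by
  have h := MvPolynomial.eval₂_eq' (algebraMap F[X] (RatFunc F)) y (coeffPoly F d r)
  simp only [c, ← h]
  rw [coeffPoly, MvPolynomial.eval₂_prod, D_eq_prod, ← Finset.prod_mul_distrib]
  refine Finset.prod_congr rfl fun j _ => ?_
  rw [← fd_mul_sub, mul_comm]
  congr 1
  rw [← MvPolynomial.coe_eval₂Hom]
  simp [fd, RatFunc.algebraMap_X]

theorem finL_eq_sum (d r k : ℕ) (hd : 1 ≤ d) :
    (finL (k - r) ![0] ![d * Fintype.card F ^ r] : RatFunc F) =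
      (-1) ^ r * D F r * ∑ m ∈ (coeffPoly F d r).support,
        algebraMap F[X] (RatFunc F) (c F d r m) * finL k (upperRow F m) (lowerRow F d r) := by
  classical
  -- Only the first product depends on `m`: it is the monomial at `y_j = θ^{q^{j+1+i_{j+1}}}`, with
  -- `j` counted from `0`.
  have hterm (m : Fin r →₀ ℕ) (i : Fin (r + 1) → ℕ) :
      (term (upperRow F m) (lowerRow F d r) i : RatFunc F) =
      (∏ j : Fin r, (RatFunc.X ^ Fintype.card F ^ ((j : ℕ) + 1 + i j.succ)) ^ m j) *
      ((l F (i 0) ^ d)⁻¹ * ∏ j : Fin r,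
        (l F (i j.succ) ^ (d * (Fintype.card F - 1) * Fintype.card F ^ (j : ℕ)))⁻¹) := by
    rw [term_eq_prod, Fin.prod_univ_succ]
    simp only [upperRow, lowerRow, Fin.cons_zero, Fin.cons_succ, zero_mul, zpow_zero, one_mul,
      div_eq_mul_inv, Finset.prod_mul_distrib]
    rw [mul_left_comm]
    congr 1
    refine Finset.prod_congr rfl fun j _ => ?_
    rw [← pow_mul, ← zpow_natCast]
    congr 1
    push_cast
    ring
  have hsum : D F r * ∑ m ∈ (coeffPoly F d r).support,
        algebraMap F[X] (RatFunc F) (c F d r m) * finL k (upperRow F m) (lowerRow F d r) =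
      ∑ i ∈ (Fintype.piFinset fun _ : Fin (r + 1) => Finset.range k) with StrictAnti i,
        ∏ j : Fin (r + 1), (Fin.cons (fun i => (l F i ^ d)⁻¹)
          (fun j : Fin r => telescopingFactor F d j r) : Fin (r + 1) → ℕ → RatFunc F) j (i j) := by
    simp only [finL, Finset.mul_sum]
    rw [Finset.sum_comm]
    refine Finset.sum_congr rfl fun i _ => ?_
    simp only [hterm, ← mul_assoc]
    rw [← Finset.sum_mul, ← Finset.sum_mul]
    simp only [mul_assoc (D F r)]
    rw [← Finset.mul_sum, D_mul_sum_coeffPoly, Fin.prod_univ_succ, mul_right_comm, mul_comm]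
    simp only [Fin.cons_zero, Fin.cons_succ, telescopingFactor, div_eq_mul_inv,
      Finset.prod_mul_distrib]
  rw [mul_assoc, hsum, sum_strictAnti_succ, finL_singleton]
  have h (n : ℕ) := sum_prod_telescopingFactor (F := F) hd r 0 n
  simp only [zero_add] at h
  simp only [Fin.cons_zero, Fin.cons_succ, h, mul_left_comm _ ((-1 : RatFunc F) ^ r)]
  rw [← Finset.mul_sum, ← mul_assoc, ← mul_pow, neg_one_mul, neg_neg, one_pow, one_mul]
  -- For `k < r` truncated subtraction makes the left side empty, and every term on the right is
  -- zero.
  rcases lt_or_ge k r with hk | hk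
  · rw [Nat.sub_eq_zero_of_le hk.le, Finset.sum_range_zero]
    refine (Finset.sum_eq_zero fun i hi => ?_).symm
    rw [telescopedValue, if_pos ((Finset.mem_range.1 hi).trans hk), mul_zero]
  obtain ⟨n, rfl⟩ := Nat.exists_eq_add_of_le hk
  rw [Finset.sum_range_add, Finset.sum_eq_zero (s := Finset.range r) fun i hi => ?_, zero_add,
    Nat.add_sub_cancel_left]
  · refine Finset.sum_congr rfl fun i _ => ?_
    have h1 := l_ne_zero (F := F) i
    have h2 := l_ne_zero (F := F) (r + i)
    rw [telescopedValue, if_neg (by omega), Nat.add_sub_cancel_left, zero_add, pow_zero, pow_one,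
      div_pow, ← pow_mul, mul_comm d]
    field_simp
  · rw [telescopedValue, if_pos (Finset.mem_range.1 hi), mul_zero]

end Carlitz

namespace Carlitz

/-! ### Convergence in `K_∞` -/

open WithZero Filter Topology

theorem withZero_exp_sum {ι : Type*} (S : Finset ι) (f : ι → ℤ) :
    exp (∑ i ∈ S, f i) = ∏ i ∈ S, exp (f i) := by
  induction S using Finset.cons_induction with
  | empty => simp
  | cons a S ha ih => rw [Finset.sum_cons, Finset.prod_cons, exp_add, ih]

theorem nonarchimedeanAddGroup_of_valued {R Γ₀ : Type*} [Ring R]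
    [LinearOrderedCommGroupWithZero Γ₀] [Valued R Γ₀] : NonarchimedeanAddGroup R where
  is_nonarchimedean U hU := by
    obtain ⟨γ, hγ⟩ := Valued.mem_nhds_zero.1 hU
    refine ⟨⟨(Valued.v : Valuation R Γ₀).restrict.ltAddSubgroup γ, ?_⟩, ?_⟩
    · exact Valued.isOpen_ball R (γ : MonoidWithZeroHom.ValueGroup₀ (.ofClass _))
    · exact hγ

variable {F : Type*} [Field F] [DecidableEq (RatFunc F)]

theorem completeSpace_completionAtInfty : CompleteSpace (RatFunc.CompletionAtInfty F) :=
  @UniformSpace.Completion.completeSpace (RatFunc F) (RatFunc.inftyValued F).toUniformSpace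

theorem v_algebraMap_completionAtInfty (x : RatFunc F) :
    Valued.v (algebraMap (RatFunc F) (RatFunc.CompletionAtInfty F) x) =
      RatFunc.inftyValuation F x := by
  let := RatFunc.inftyValued F
  exact Valued.valuedCompletion_apply x

/-- In a complete nonarchimedean group, terms tending to zero along the cofinite filter suffice. -/
theorem summable_completionAtInfty {ι : Type*} (f : ι → RatFunc.CompletionAtInfty F)
    (h : ∀ g : ℤ, {i | exp g ≤ Valued.v (f i)}.Finite) : Summable f := by
  have := completeSpace_completionAtInfty (F := F)
  have := nonarchimedeanAddGroup_of_valued (R := RatFunc.CompletionAtInfty F)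
  refine NonarchimedeanAddGroup.summable_of_tendsto_cofinite_zero fun U hU => ?_
  obtain ⟨γ, hγ⟩ := Valued.mem_nhds_zero.1 hU
  have hγ0 : MonoidWithZeroHom.ValueGroup₀.embedding γ.1 ≠ (0 : ℤᵐ⁰) := by
    simp
  refine Set.Finite.subset (h (log (MonoidWithZeroHom.ValueGroup₀.embedding γ.1))) fun i hi => ?_
  rw [Set.mem_ofPred_eq, exp_log hγ0]
  by_contra hlt
  exact hi (hγ ((Valuation.restrict_lt_iff_lt_embedding _).2 (not_le.1 hlt)))

variable [Fintype F]

theorem inftyValuation_l (n : ℕ) :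
    RatFunc.inftyValuation F (l F n) =
      exp (∑ j ∈ Finset.range n, (Fintype.card F : ℤ) ^ (j + 1)) := by
  rw [l, map_prod, withZero_exp_sum]
  refine Finset.prod_congr rfl fun j _ => ?_
  have hpow : RatFunc.inftyValuation F (RatFunc.X ^ Fintype.card F ^ (j + 1)) =
      exp ((Fintype.card F : ℤ) ^ (j + 1)) := by
    rw [map_pow, RatFunc.inftyValuation.X, ← exp_nsmul]
    simp
  rw [Valuation.map_sub_eq_of_lt_right, hpow]
  rw [hpow, RatFunc.inftyValuation.X, exp_lt_exp]
  exact_mod_cast one_lt_card_pow_succ j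

theorem inftyValuation_term {s : ℕ} (m : Fin s → ℤ) (n i : Fin s → ℕ) :
    RatFunc.inftyValuation F (term m n i) =
      exp (∑ j, (m j * (Fintype.card F : ℤ) ^ i j -
        n j * ∑ t ∈ Finset.range (i j), (Fintype.card F : ℤ) ^ (t + 1))) := by
  rw [term_eq_prod, map_prod, withZero_exp_sum]
  refine Finset.prod_congr rfl fun j _ => ?_
  rw [map_div₀, RatFunc.inftyValuation.X_zpow, map_pow, inftyValuation_l, exp_sub, ← exp_nsmul,
    nsmul_eq_mul]

theorem finite_strictAnti_head_le {s : ℕ} (N : ℕ) :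
    {i : {i : Fin (s + 1) → ℕ // StrictAnti i} | i.1 0 ≤ N}.Finite := by
  refine Set.Finite.of_finite_image (f := Subtype.val) ?_ Subtype.val_injective.injOn
  refine (Set.finite_Iic (fun _ => N)).subset ?_
  rintro _ ⟨i, hi, rfl⟩ j
  exact (i.2.antitone (Fin.zero_le j)).trans hi

/-- The hypothesis bounds the degree of the term. Degree at least `g` forces `i 0 ≤ C - g`, and the
head bounds all other entries. -/
theorem summable_termInfty {s : ℕ} (m : Fin (s + 1) → ℤ) (n : Fin (s + 1) → ℕ) (C : ℤ)
    (h : ∀ i : Fin (s + 1) → ℕ, ∑ j, (m j * (Fintype.card F : ℤ) ^ i j -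
        n j * ∑ t ∈ Finset.range (i j), (Fintype.card F : ℤ) ^ (t + 1)) ≤ C - i 0) :
    Summable (termInfty (F := F) m n) := by
  refine summable_completionAtInfty _ fun g => ?_
  refine (finite_strictAnti_head_le (C - g).toNat).subset fun i hi => ?_
  rw [Set.mem_ofPred_eq, termInfty, v_algebraMap_completionAtInfty, inftyValuation_term,
    exp_le_exp] at hi
  have := h i.1
  simp only [Set.mem_ofPred_eq]
  omega

omit [DecidableEq (RatFunc F)] in
theorem le_sum_card_pow (n : ℕ) :
    (n : ℤ) ≤ ∑ t ∈ Finset.range n, (Fintype.card F : ℤ) ^ (t + 1) := by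
  calc (n : ℤ) = ∑ t ∈ Finset.range n, 1 := by simp
    _ ≤ _ := Finset.sum_le_sum fun t _ => by
      exact_mod_cast Nat.one_le_pow _ _ Fintype.card_pos

theorem summable_termInfty_singleton {N : ℕ} (hN : 1 ≤ N) :
    Summable (termInfty (F := F) ![0] ![N]) := by
  refine summable_termInfty _ _ 0 fun i => ?_
  have h := le_sum_card_pow (F := F) (i 0)
  have hN' : (1 : ℤ) ≤ N := by exact_mod_cast hN
  simp
  nlinarith

omit [DecidableEq (RatFunc F)] in
theorem le_of_mem_support_coeffPoly {d r : ℕ} {m : Fin r →₀ ℕ}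
    (hm : m ∈ (coeffPoly F d r).support) (j : Fin r) : m j ≤ d := by
  classical
  have hlin (a : F[X]) (k : Fin r) :
      MvPolynomial.degreeOf j (MvPolynomial.C a - MvPolynomial.X k) ≤ if j = k then 1 else 0 := by
    refine (MvPolynomial.degreeOf_sub_le _ _ _).trans ?_
    simp [MvPolynomial.degreeOf_X]
  refine (MvPolynomial.monomial_le_degreeOf j hm).trans
    ((MvPolynomial.degreeOf_prod_le _ _ _).trans ?_)
  calc _ ≤ ∑ k : Fin r, if j = k then d else 0 := Finset.sum_le_sum fun k _ => ?_
    _ = d := by simp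
  refine (MvPolynomial.degreeOf_sum_le _ _ _).trans (Finset.sup_le fun e he => ?_)
  refine (MvPolynomial.degreeOf_mul_le _ _ _).trans ?_
  refine (add_le_add ((MvPolynomial.degreeOf_pow_le _ _ _).trans (Nat.mul_le_mul_left _ (hlin _ _)))
    ((MvPolynomial.degreeOf_pow_le _ _ _).trans (Nat.mul_le_mul_left _ (hlin _ _)))).trans ?_
  have := Finset.mem_range.1 he
  split_ifs <;> omega

/-- As `m_j ≤ d` and `(q-1)(q + ⋯ + q^i) = q(q^i - 1)`, each inner factor has degree at most `d
q^{j+1}`, whatever `i` is. The decay comes from `l_{i_0}^{-d}` alone. -/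
theorem summable_termInfty_rows {d r : ℕ} (hd : 1 ≤ d) {m : Fin r →₀ ℕ}
    (hm : m ∈ (coeffPoly F d r).support) :
    Summable (termInfty (F := F) (upperRow F m) (lowerRow F d r)) := by
  refine summable_termInfty _ _
    (∑ j : Fin r, (d : ℤ) * (Fintype.card F : ℤ) ^ ((j : ℕ) + 1)) fun i => ?_
  have hd' : (1 : ℤ) ≤ d := by exact_mod_cast hd
  have h0 := le_sum_card_pow (F := F) (i 0)
  have hq : (1 : ℤ) ≤ Fintype.card F := by exact_mod_cast Fintype.card_pos
  rw [Fin.sum_univ_succ]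
  simp only [upperRow, lowerRow, Fin.cons_zero, Fin.cons_succ]
  have hj : ∀ j : Fin r, (m j : ℤ) * (Fintype.card F : ℤ) ^ ((j : ℕ) + 1) *
      (Fintype.card F : ℤ) ^ i j.succ -
      ((d * (Fintype.card F - 1) * Fintype.card F ^ (j : ℕ) : ℕ) : ℤ) *
        ∑ t ∈ Finset.range (i j.succ), (Fintype.card F : ℤ) ^ (t + 1) ≤
      (d : ℤ) * (Fintype.card F : ℤ) ^ ((j : ℕ) + 1) := by
    intro j
    have hmj : (m j : ℤ) ≤ d := by exact_mod_cast le_of_mem_support_coeffPoly hm j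
    have hgeom : ((Fintype.card F : ℤ) - 1) *
        ∑ t ∈ Finset.range (i j.succ), (Fintype.card F : ℤ) ^ (t + 1) =
        Fintype.card F * ((Fintype.card F : ℤ) ^ i j.succ - 1) := by
      rw [← mul_geom_sum, Finset.mul_sum, Finset.mul_sum, Finset.mul_sum]
      exact Finset.sum_congr rfl fun t _ => by ring
    have hlow : ((d * (Fintype.card F - 1) * Fintype.card F ^ (j : ℕ) : ℕ) : ℤ) *
        ∑ t ∈ Finset.range (i j.succ), (Fintype.card F : ℤ) ^ (t + 1) =
        d * (Fintype.card F : ℤ) ^ (j : ℕ) *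
          (Fintype.card F * ((Fintype.card F : ℤ) ^ i j.succ - 1)) := by
      rw [← hgeom]
      push_cast [Nat.cast_sub (Fintype.card_pos (α := F))]
      ring
    rw [hlow]
    have hpos : (0 : ℤ) ≤ (Fintype.card F : ℤ) ^ ((j : ℕ) + 1) *
      (Fintype.card F : ℤ) ^ i j.succ := by positivity
    have := mul_le_mul_of_nonneg_right hmj hpos
    rw [pow_succ] at this ⊢
    linarith
  have := Finset.sum_le_sum fun j (_ : j ∈ Finset.univ) => hj j
  have : (i 0 : ℤ) ≤ d * ∑ t ∈ Finset.range (i 0), (Fintype.card F : ℤ) ^ (t + 1) := by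
    nlinarith
  linarith

/-- The finite multiple sums converge to the value of the series. -/
theorem tendsto_finL {s : ℕ} {m : Fin (s + 1) → ℤ} {n : Fin (s + 1) → ℕ}
    (h : Summable (termInfty (F := F) m n)) :
    Tendsto (fun k => algebraMap (RatFunc F) (RatFunc.CompletionAtInfty F) (finL k m n)) atTop
      (𝓝 (L m n)) := by
  classical
  let S (k : ℕ) : Finset {i : Fin (s + 1) → ℕ // StrictAnti i} :=
    (Fintype.piFinset fun _ => Finset.range k).subtype StrictAnti
  have hS : Tendsto S atTop atTop := by
    refine tendsto_atTop_finset_of_monotone (fun a b hab i hi => ?_) fun i => ⟨i.1 0 + 1, ?_⟩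
    · simp only [S, Finset.mem_subtype, Fintype.mem_piFinset, Finset.mem_range] at hi ⊢
      exact fun j => (hi j).trans_le hab
    · simp only [S, Finset.mem_subtype, Fintype.mem_piFinset, Finset.mem_range]
      exact fun j => Nat.lt_succ_of_le (i.2.antitone (Fin.zero_le j))
  refine (h.hasSum.comp hS).congr fun k => ?_
  simp only [Function.comp_apply, S, termInfty]
  rw [Finset.sum_subtype_eq_sum_filter (f := fun i : Fin (s + 1) → ℕ =>
    algebraMap (RatFunc F) (RatFunc.CompletionAtInfty F) (term m n i)), finL, map_sum]

end Carlitz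
-- Passage to the limit
theorem theoremC (F : Type*) [Field F] [Fintype F] [DecidableEq (RatFunc F)]
    (d r : ℕ) (hd : 1 ≤ d) (hr : 1 ≤ r) :
    -- the identity of finite sums in `K`
    (∀ k : ℕ, r ≤ k →
      (Carlitz.finL (k - r) ![0] ![d * Fintype.card F ^ r] : RatFunc F) =
        (-1) ^ r * Carlitz.D F r *
          ∑ m ∈ (Carlitz.coeffPoly F d r).support,
            algebraMap F[X] (RatFunc F) (Carlitz.c F d r m) *
              Carlitz.finL k (Carlitz.upperRow F m) (Carlitz.lowerRow F d r)) ∧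
    -- the series below converge in `K_∞`
    Summable (Carlitz.termInfty (F := F) ![0] ![d * Fintype.card F ^ r]) ∧
    (∀ m ∈ (Carlitz.coeffPoly F d r).support,
      Summable (Carlitz.termInfty (F := F) (Carlitz.upperRow F m) (Carlitz.lowerRow F d r))) ∧
    -- the identity of the values in `K_∞`
    (Carlitz.L ![0] ![d * Fintype.card F ^ r] : RatFunc.CompletionAtInfty F) =
      algebraMap (RatFunc F) (RatFunc.CompletionAtInfty F) ((-1) ^ r * Carlitz.D F r) *
        ∑ m ∈ (Carlitz.coeffPoly F d r).support,
          algebraMap (RatFunc F) (RatFunc.CompletionAtInfty F)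
              (algebraMap F[X] (RatFunc F) (Carlitz.c F d r m)) *
            Carlitz.L (Carlitz.upperRow F m) (Carlitz.lowerRow F d r) := by
  have hsum := Carlitz.summable_termInfty_singleton (F := F)
    (Nat.mul_pos hd (pow_pos (Fintype.card_pos (α := F)) r))
  have hrows (m) (hm : m ∈ (Carlitz.coeffPoly F d r).support) :=
    Carlitz.summable_termInfty_rows hd hm
  refine ⟨fun k _ => Carlitz.finL_eq_sum d r k hd, hsum, hrows, ?_⟩
  refine tendsto_nhds_unique ((Carlitz.tendsto_finL hsum).comp (Filter.tendsto_sub_atTop_nat r)) ?_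
  refine ((tendsto_finsetSum _ fun m hm =>
    (Carlitz.tendsto_finL (hrows m hm)).const_mul _).const_mul _).congr fun k => ?_
  rw [Function.comp_apply, Carlitz.finL_eq_sum d r k hd]
  simp only [map_mul, map_sum]
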